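/- Let $I_1,\dots,I_N$ be dimensions and $r=I_1\cdots I_N$. Square tensors in $\mathbb C^{I_1\times\cdots\times I_N\times I_1\times\cdots\times I_N}$ are multiplied by the Einstein product $(X\star Y)_{i,j}=\sum_k X_{i,k}Y_{k,j}$ (with multi-indices $i,j,k$), and the conjugate transpose is $(X^H)_{i,j}=\overline{X_{j,i}}$. A nonnegative Hermitian tensor $A$ is one with $A^H=A$ whose Hermitian eigenvalues, listed with multiplicity as $\lambda_1(A)\ge\cdots\ge\lambda_r(A)$, are all $\ge 0$. A unitarily invariant norm $\|\cdot\|_\rho$ is a norm on these tensors with $\|U\star X\|_\rho=\|X\star U\|_\rho=\|X\|_\rho$ for all tensors $X$ and all unitary tensors $U$. Conventions: $\log 0=-\infty$, $\log\infty=\infty$, $e^{-\infty}=0$, $e^{\infty}=\infty$. A function $h:(0,\infty)\to[0,\infty)$ for which the limit $h(0^+)=\lim_{t\downarrow0}h(t)\in[0,\infty]$ exists is extended by $h(0)=h(0^+)$. For a nonnegative Hermitian tensor $A$, $h(A)$ is formed by spectral calculus, and $\|h(A)\|_\rho=\infty$ if $h$ is infinite at an eigenvalue of $A$ (so $\|A^{-p}\|_\rho=\infty$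 for singular $A$ and $p>0$). For nonnegative vectors $x_1\ge\cdots\ge x_r$ and $y_1\ge\cdots\ge y_r$, the log-majorization $x\prec_{\log}y$ means $\prod_{i\le k}x_i\le\prod_{i\le k}y_i$ for $1\le k\le r$, with equality for $k=r$. Let $\Omega$ be a $\sigma$-compact metric space, $\nu$ a Borel probability measure on $\Omega$, $C$ a nonnegative Hermitian tensor, and $\tau\mapsto D_\tau$ a continuous map from $\Omega$ to nonnegative Hermitian tensors that is bounded in norm. Suppose that $\int_\Omega\|D_\tau^{-p}\|_{\rho_0}\,d\nu(\tau)<\infty$ for some $p>0$ and some unitarily invariant norm $\|\cdot\|_{\rho_0}$. Then the following three statements are equivalent: 1. $\displaystyle(\lambda_1(C),\dots,\lambda_r(C))\prec_{\log}\Big(\exp\int_\Omega\log\lambda_1(D_\tau)\,d\nu(\tau),\dots,\exp\int_\Omega\log\lambda_r(D_\tau)\,d\nu(\tau)\Big)$; 2. for every unitarily invariant norm $\|\cdot\|_\rho$ and every continuous $f:(0,\infty)\to[0,\infty)$ such that $x\mapsto\log f(e^x)$ is convex on $\mathbb R$ (with values in $[-\infty,\infty)$), $$\|f(C)\|_\rho\le\exp\int_\Omega\log\|f(D_\tau)\|_\rho\,d\nu(\tau);$$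 3. for every unitarily invariant norm $\|\cdot\|_\rho$ and every continuous $g:(0,\infty)\to[0,\infty)$ such that $x\mapsto g(e^x)$ is convex on $\mathbb R$, $$\|g(C)\|_\rho\le\int_\Omega\|g(D_\tau)\|_\rho\,d\nu(\tau).$$ Here the integrals of logarithms are taken in $[-\infty,\infty]$ and the last integral in $[0,\infty]$. -/

import Mathlib

open MeasureTheory Filter Topology
open scoped ENNReal Matrix ComplexOrder

/-- Multi-indices `(i₁, …, i_N)` with `i_k` ranging over `I k` values. -/
abbrev MultiIndex {N : ℕ} (I : Fin N → ℕ) : Type := (k : Fin N) → Fin (I k)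

/-- Square complex tensors of size `I₁ × ⋯ × I_N × I₁ × ⋯ × I_N`, the entry at
`(i₁, …, i_N, j₁, …, j_N)` being `X i j`. The matrix product over multi-indices is the Einstein
product `(X ⋆ Y) i k = ∑ j, X i j * Y j k`, and `Xᴴ` is the conjugate transpose tensor. -/
abbrev SquareTensor {N : ℕ} (I : Fin N → ℕ) : Type := Matrix (MultiIndex I) (MultiIndex I) ℂ

/-- The number `r = I₁ ⋯ I_N` of Hermitian eigenvalues, counted with multiplicity. -/
abbrev tensorDim {N : ℕ} (I : Fin N → ℕ) : ℕ := Fintype.card (MultiIndex I)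

/-- The vector of Hermitian eigenvalues in decreasing order, with multiplicity. -/
noncomputable def eigVec {N : ℕ} {I : Fin N → ℕ} {A : SquareTensor I} (hA : A.IsHermitian) :
    Fin (tensorDim I) → ℝ := hA.eigenvalues₀

/-- The Frobenius norm `√Tr(Xᴴ ⋆ X)`. -/
noncomputable def frobNorm {N : ℕ} {I : Fin N → ℕ} (X : SquareTensor I) : ℝ :=
  Real.sqrt (Matrix.trace (Xᴴ * X)).re

/-- A unitarily invariant norm on square tensors: a complex vector space norm that does not change
under multiplication by a unitary tensor on either side. -/
structure UnitarilyInvariantNorm {N : ℕ} (I : Fin N → ℕ) extends Seminorm ℂ (SquareTensor I) where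
  eq_zero_of_map_eq_zero : ∀ X : SquareTensor I, toFun X = 0 → X = 0
  unitary_mul : ∀ U ∈ Matrix.unitaryGroup (MultiIndex I) ℂ, ∀ X : SquareTensor I,
    toFun (U * X) = toFun X
  mul_unitary : ∀ U ∈ Matrix.unitaryGroup (MultiIndex I) ℂ, ∀ X : SquareTensor I,
    toFun (X * U) = toFun X

/-- A function `f : (0, ∞) → [0, ∞)` extended to `0` by `f(0) = f(0⁺) = lim_{t ↓ 0} f(t)`, which
may be `∞`. -/
noncomputable def extendZero (f : ℝ → ℝ) (x : ℝ) : ℝ≥0∞ :=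
  if 0 < x then ENNReal.ofReal (f x)
  else limUnder (𝓝[>] (0 : ℝ)) (fun t => ENNReal.ofReal (f t))

open scoped Classical in
/-- `‖f(A)‖` for a nonnegative Hermitian tensor `A` and a function `f : (0, ∞) → [0, ∞)`, extended
to `0` by its limit `f(0⁺) ∈ [0, ∞]`; here `f(A)` is formed by the spectral functional calculus,
and `‖f(A)‖ = ∞` if `f` is infinite at one of the eigenvalues of `A`. -/
noncomputable def UnitarilyInvariantNorm.normFun {N : ℕ} {I : Fin N → ℕ}
    (ρ : UnitarilyInvariantNorm I) (f : ℝ → ℝ) {A : SquareTensor I} (hA : A.PosSemidef) : ℝ≥0∞ :=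
  if ∃ i, extendZero f (eigVec hA.isHermitian i) = ∞ then ∞
  else ENNReal.ofReal (ρ.toSeminorm (hA.isHermitian.cfc fun x => (extendZero f x).toReal))

/-- The integral of an extended real valued function, as the integral of the positive part minus
that of the negative part. -/
noncomputable def ereal_integral {Ω : Type*} [MeasurableSpace Ω] (ν : Measure Ω)
    (F : Ω → EReal) : EReal :=
  ((∫⁻ τ, (F τ).toENNReal ∂ν : ℝ≥0∞) : EReal) - ((∫⁻ τ, (-F τ).toENNReal ∂ν : ℝ≥0∞) : EReal)

/-- `exp ∫ log h dν` for a function `h` with values in `[0, ∞]`, with the conventions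
`log 0 = -∞`, `log ∞ = ∞`, `exp (-∞) = 0`, `exp ∞ = ∞`. -/
noncomputable def expIntLog {Ω : Type*} [MeasurableSpace Ω] (ν : Measure Ω)
    (h : Ω → ℝ≥0∞) : ℝ≥0∞ :=
  EReal.exp (ereal_integral ν fun τ => ENNReal.log (h τ))

/-- Log-majorization `x ≺_log y` of vectors whose entries are listed in decreasing order. -/
def LogMajorizedBy {r : ℕ} (x y : Fin r → ℝ≥0∞) : Prop :=
  (∀ k : ℕ, 1 ≤ k → k ≤ r →
    ∏ i with (Fin.val i) < k, x i ≤ ∏ i with (Fin.val i) < k, y i) ∧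
  ∏ i, x i = ∏ i, y i

/-- `f` restricts to a continuous function `(0, ∞) → [0, ∞)`. -/
def IsContNonneg (f : ℝ → ℝ) : Prop :=
  ContinuousOn f (Set.Ioi 0) ∧ ∀ x, 0 < x → 0 ≤ f x

/-- `x ↦ log f(eˣ)` is convex on `ℝ`, as a function with values in `[-∞, ∞)`. -/
def LogConvexExp (f : ℝ → ℝ) : Prop :=
  ∀ x y a b : ℝ, 0 < a → 0 < b → a + b = 1 →
    ENNReal.log (ENNReal.ofReal (f (Real.exp (a * x + b * y)))) ≤
      (a : EReal) * ENNReal.log (ENNReal.ofReal (f (Real.exp x))) +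
      (b : EReal) * ENNReal.log (ENNReal.ofReal (f (Real.exp y)))

/-! In logarithms, condition 1 says that C is invertible and that the vector x of log λ_i(C) is
majorized by the mean of the vectors y(τ) of log λ_i(D_τ). The negative moment and the boundedness
of D make these logarithms integrable (`logIntegrable`).

1 ⇒ 2, 3: a unitarily invariant norm of a Hermitian tensor is a symmetric gauge function of its
eigenvalues, so both inequalities are of Jensen type for a symmetric convex F, namely v ↦
gauge(g(e^v)) or v ↦ log gauge(f(e^v)). Majorization gives F(x) ≤ F(mean of y), convexity gives
F(mean of y) ≤ ∫ F(y). `exists_integrable_minorant` does both at once through an affine minorant of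
F, because F(y) itself may fail to be integrable.

2, 3 ⇒ 1 (`logMajorizedBy_of_normFun_rpow_le`): test on powers t^q, where 2 implies 3 by Jensen for
log. Ky Fan k-norms with q > 0 compare the sums of e^{q x_i} and ∫ e^{q y_i} over i < k; subtracting
k, dividing by q and letting q ↓ 0 compares the partial sums. The Ky Fan r-norm with q < 0 reverses
the inequality for the total sum, and q = -p forces C to be invertible. -/

/-! ### Symmetric gauge functions. -/

section Gauge

variable {N : ℕ} {I : Fin N → ℕ}

/-- The enumeration of multi-indices used for listing eigenvalues. -/
noncomputable def indexEquiv (I : Fin N → ℕ) : MultiIndex I ≃ Fin (tensorDim I) :=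
  (Fintype.equivOfCardEq (Fintype.card_fin _)).symm

lemma permMatrix_mem_unitaryGroup {n : Type*} [Fintype n] [DecidableEq n] (σ : Equiv.Perm n) :
    σ.permMatrix ℂ ∈ Matrix.unitaryGroup n ℂ := by
  rw [Matrix.mem_unitaryGroup_iff, Matrix.star_eq_conjTranspose, Matrix.conjTranspose_permMatrix,
    ← Matrix.permMatrix_mul]
  simp

lemma diagonal_mem_unitaryGroup {n : Type*} [Fintype n] [DecidableEq n] {u : n → ℂ}
    (hu : ∀ i, ‖u i‖ = 1) : Matrix.diagonal u ∈ Matrix.unitaryGroup n ℂ := by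
  rw [Matrix.mem_unitaryGroup_iff, Matrix.star_eq_conjTranspose, Matrix.diagonal_conjTranspose,
    Matrix.diagonal_mul_diagonal, ← Matrix.diagonal_one]
  congr 1
  funext i
  simp [Complex.mul_conj, Complex.normSq_eq_norm_sq, hu]

namespace UnitarilyInvariantNorm

variable (ρ : UnitarilyInvariantNorm I)

lemma map_unitary_mul {U : SquareTensor I} (hU : U ∈ Matrix.unitaryGroup (MultiIndex I) ℂ)
    (X : SquareTensor I) : ρ.toSeminorm (U * X) = ρ.toSeminorm X := ρ.unitary_mul U hU X

lemma map_mul_unitary {U : SquareTensor I} (hU : U ∈ Matrix.unitaryGroup (MultiIndex I) ℂ)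
    (X : SquareTensor I) : ρ.toSeminorm (X * U) = ρ.toSeminorm X := ρ.mul_unitary U hU X

/-- The symmetric gauge function of a unitarily invariant norm. -/
noncomputable def gauge (v : Fin (tensorDim I) → ℝ) : ℝ :=
  ρ.toSeminorm (Matrix.diagonal fun i => (v (indexEquiv I i) : ℂ))

lemma gauge_nonneg (v : Fin (tensorDim I) → ℝ) : 0 ≤ ρ.gauge v := apply_nonneg _ _

lemma gauge_add_le (v w : Fin (tensorDim I) → ℝ) : ρ.gauge (v + w) ≤ ρ.gauge v + ρ.gauge w := by
  refine le_trans (le_of_eq ?_) (map_add_le_add ρ.toSeminorm _ _)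
  rw [gauge, Matrix.diagonal_add]
  simp

lemma gauge_smul {c : ℝ} (hc : 0 ≤ c) (v : Fin (tensorDim I) → ℝ) :
    ρ.gauge (c • v) = c * ρ.gauge v := by
  have h := map_smul_eq_mul ρ.toSeminorm (c : ℂ)
    (Matrix.diagonal fun i => (v (indexEquiv I i) : ℂ))
  rw [← Matrix.diagonal_smul, Complex.norm_real, Real.norm_of_nonneg hc] at h
  rw [gauge, gauge, ← h]
  congr 2
  funext i
  simp

lemma gauge_comp_perm (σ : Equiv.Perm (Fin (tensorDim I))) (v : Fin (tensorDim I) → ℝ) :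
    ρ.gauge (v ∘ σ) = ρ.gauge v := by
  set π : Equiv.Perm (MultiIndex I) := ((indexEquiv I).trans σ).trans (indexEquiv I).symm with hπ
  have h : (Matrix.diagonal fun i => ((v ∘ σ) (indexEquiv I i) : ℂ)) =
      π.permMatrix ℂ * (Matrix.diagonal fun i => (v (indexEquiv I i) : ℂ)) *
        π⁻¹.permMatrix ℂ := by
    rw [Equiv.Perm.permMatrix, Equiv.Perm.permMatrix, PEquiv.toMatrix_toPEquiv_mul,
      PEquiv.mul_toMatrix_toPEquiv]
    ext i j
    simp [Matrix.diagonal_apply, hπ, Equiv.Perm.inv_def]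
  rw [gauge, h, map_mul_unitary _ (permMatrix_mem_unitaryGroup _),
    map_unitary_mul _ (permMatrix_mem_unitaryGroup _), gauge]

lemma gauge_eq_zero_iff {v : Fin (tensorDim I) → ℝ} : ρ.gauge v = 0 ↔ v = 0 := by
  constructor
  · intro h
    have h1 := ρ.eq_zero_of_map_eq_zero _ h
    funext k
    have h2 := congrFun (congrFun h1 ((indexEquiv I).symm k)) ((indexEquiv I).symm k)
    simpa using h2
  · rintro rfl
    have h := ρ.gauge_smul le_rfl 0
    simpa using h

/-- A number a in [0, b] is the average of ub and its conjugate, where |u| = 1 and Re u = a / b.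
Hence the smaller diagonal tensor is the average of two unitary multiples of the larger one. -/
lemma gauge_mono {v w : Fin (tensorDim I) → ℝ} (hv : 0 ≤ v) (hvw : v ≤ w) :
    ρ.gauge v ≤ ρ.gauge w := by
  have key : ∀ a b : ℝ, 0 ≤ a → a ≤ b →
      ∃ u : ℂ, ‖u‖ = 1 ∧ (a : ℂ) = 2⁻¹ * (u * b) + 2⁻¹ * ((starRingEnd ℂ) u * b) := by
    intro a b ha hab
    refine ⟨Complex.exp (Real.arccos (a / b) * Complex.I),
      Complex.norm_exp_ofReal_mul_I _, ?_⟩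
    have h1 : Real.cos (Real.arccos (a / b)) = a / b :=
      Real.cos_arccos (by linarith [div_nonneg ha (ha.trans hab)])
        (div_le_one_of_le₀ hab (ha.trans hab))
    have h2 := Complex.add_conj (Complex.exp (Real.arccos (a / b) * Complex.I))
    rw [Complex.exp_ofReal_mul_I_re, h1] at h2
    rw [← mul_add, ← add_mul, h2]
    rcases eq_or_ne b 0 with rfl | hb
    · have : a = 0 := le_antisymm hab ha
      simp [this]
    · have : (b : ℂ) ≠ 0 := by exact_mod_cast hb
      push_cast
      field_simp
  choose u hu1 hu2 using fun i : MultiIndex I => key (v (indexEquiv I i)) (w (indexEquiv I i))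
    (hv _) (hvw _)
  set W : SquareTensor I := Matrix.diagonal fun i => (w (indexEquiv I i) : ℂ)
  have hV : (Matrix.diagonal fun i => (v (indexEquiv I i) : ℂ)) =
      (2⁻¹ : ℂ) • (Matrix.diagonal u * W) +
        (2⁻¹ : ℂ) • (Matrix.diagonal (fun i => (starRingEnd ℂ) (u i)) * W) := by
    rw [Matrix.diagonal_mul_diagonal, Matrix.diagonal_mul_diagonal, ← Matrix.diagonal_smul,
      ← Matrix.diagonal_smul, Matrix.diagonal_add]
    congr 1
    funext i
    simpa using hu2 i
  rw [gauge, hV]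
  refine (map_add_le_add _ _ _).trans ?_
  rw [map_smul_eq_mul, map_smul_eq_mul, ρ.map_unitary_mul (diagonal_mem_unitaryGroup hu1),
    ρ.map_unitary_mul (diagonal_mem_unitaryGroup (by simpa using hu1)), gauge]
  norm_num
  linarith

lemma gauge_pos {v : Fin (tensorDim I) → ℝ} (hv : v ≠ 0) : 0 < ρ.gauge v :=
  lt_of_le_of_ne (ρ.gauge_nonneg v) fun h => hv (ρ.gauge_eq_zero_iff.1 h.symm)

lemma map_cfc {A : SquareTensor I} (hA : A.IsHermitian) (f : ℝ → ℝ) :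
    ρ.toSeminorm (hA.cfc f) = ρ.gauge fun k => f (eigVec hA k) := by
  rw [Matrix.IsHermitian.cfc, Unitary.conjStarAlgAut_apply,
    ρ.map_mul_unitary (Unitary.star_mem hA.eigenvectorUnitary.2),
    ρ.map_unitary_mul hA.eigenvectorUnitary.2]
  rfl

lemma convexOn_gauge_comp {φ : ℝ → ℝ} (hφ0 : ∀ t, 0 ≤ φ t) (hφ : ConvexOn ℝ Set.univ φ) :
    ConvexOn ℝ Set.univ fun x : Fin (tensorDim I) → ℝ => ρ.gauge fun k => φ (x k) := by
  refine ⟨convex_univ, fun x _ y _ a b ha hb hab => ?_⟩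
  calc ρ.gauge (fun k => φ ((a • x + b • y) k))
      ≤ ρ.gauge (a • (fun k => φ (x k)) + b • (fun k => φ (y k))) :=
        ρ.gauge_mono (fun k => hφ0 _) fun k => hφ.2 trivial trivial ha hb hab
    _ ≤ _ := (ρ.gauge_add_le _ _).trans_eq (by rw [ρ.gauge_smul ha, ρ.gauge_smul hb]; rfl)

/-- Hölder's argument: divide the two vectors by their gauges α and β, apply convexity of exp in
each coordinate, then use the triangle inequality. The factor e^s is α^a β^b. -/
lemma convexOn_log_gauge_exp [Nonempty (Fin (tensorDim I))] {φ : ℝ → ℝ}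
    (hφ : ConvexOn ℝ Set.univ φ) :
    ConvexOn ℝ Set.univ
      fun x : Fin (tensorDim I) → ℝ => Real.log (ρ.gauge fun k => Real.exp (φ (x k))) := by
  have hpos : ∀ v : Fin (tensorDim I) → ℝ, 0 < ρ.gauge fun k => Real.exp (v k) := fun v =>
    ρ.gauge_pos fun h => (Real.exp_pos _).ne' (congrFun h (Classical.arbitrary _))
  refine ⟨convex_univ, fun x _ y _ a b ha hb hab => ?_⟩
  set α := ρ.gauge fun k => Real.exp (φ (x k)) with hα
  set β := ρ.gauge fun k => Real.exp (φ (y k)) with hβ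
  have hα0 : 0 < α := hpos _
  have hβ0 : 0 < β := hpos _
  set s := a * Real.log α + b * Real.log β with hs
  have hterm : ∀ k, Real.exp (φ ((a • x + b • y) k)) ≤
      Real.exp s * (a * (Real.exp (φ (x k)) / α) + b * (Real.exp (φ (y k)) / β)) := by
    intro k
    have h1 : φ ((a • x + b • y) k) ≤ a * φ (x k) + b * φ (y k) :=
      hφ.2 trivial trivial ha hb hab
    have h2 := convexOn_exp.2 (Set.mem_univ (φ (x k) - Real.log α))
      (Set.mem_univ (φ (y k) - Real.log β)) ha hb hab
    simp only [smul_eq_mul, Real.exp_sub, Real.exp_log hα0, Real.exp_log hβ0] at h2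
    calc Real.exp (φ ((a • x + b • y) k))
        ≤ Real.exp (s + (a * (φ (x k) - Real.log α) + b * (φ (y k) - Real.log β))) := by
          apply Real.exp_le_exp.2
          rw [hs]
          linarith
      _ ≤ _ := by
          rw [Real.exp_add]
          exact mul_le_mul_of_nonneg_left h2 (Real.exp_pos _).le
  have h3 : ρ.gauge (fun k => Real.exp (φ ((a • x + b • y) k))) ≤ Real.exp s := by
    refine (ρ.gauge_mono (fun k => (Real.exp_pos _).le) (w := Real.exp s •
      ((a / α) • (fun k => Real.exp (φ (x k))) + (b / β) • (fun k => Real.exp (φ (y k)))))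
      fun k => (hterm k).trans_eq ?_).trans ?_
    · simp only [Pi.smul_apply, Pi.add_apply, smul_eq_mul]
      ring
    · rw [ρ.gauge_smul (Real.exp_pos _).le]
      refine mul_le_of_le_one_right (Real.exp_pos _).le ((ρ.gauge_add_le _ _).trans_eq ?_)
      rw [ρ.gauge_smul (by positivity), ρ.gauge_smul (by positivity), ← hα, ← hβ]
      field_simp
      exact hab
  simpa [hs] using (Real.log_le_iff_le_exp (hpos _)).2 h3

end UnitarilyInvariantNorm

end Gauge

/-! ### Ky Fan norms and continuity of the eigenvalues. -/

section KyFan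

variable {N : ℕ} {I : Fin N → ℕ}

/-- The sum of the moduli of the first `k` diagonal entries. -/
noncomputable def diagSum (k : ℕ) (X : SquareTensor I) : ℝ :=
  ∑ i with (indexEquiv I i).val < k, ‖X i i‖

/-- The Ky Fan `k`-norm, in its variational form. -/
noncomputable def kyFanFun (k : ℕ) (X : SquareTensor I) : ℝ :=
  ⨆ p : Matrix.unitaryGroup (MultiIndex I) ℂ × Matrix.unitaryGroup (MultiIndex I) ℂ,
    diagSum k (p.1.1 * X * p.2.1)

lemma bddAbove_diagSum (k : ℕ) (X : SquareTensor I) :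
    BddAbove (Set.range fun p : Matrix.unitaryGroup (MultiIndex I) ℂ ×
      Matrix.unitaryGroup (MultiIndex I) ℂ => diagSum k (p.1.1 * X * p.2.1)) := by
  refine ⟨∑ i with (indexEquiv I i).val < k, ∑ a, ∑ b, ‖X b a‖, ?_⟩
  rintro _ ⟨p, rfl⟩
  refine Finset.sum_le_sum fun i _ => ?_
  rw [Matrix.mul_apply]
  refine (norm_sum_le _ _).trans (Finset.sum_le_sum fun a _ => ?_)
  rw [norm_mul, Matrix.mul_apply]
  refine (mul_le_of_le_one_right (norm_nonneg _) (entry_norm_bound_of_unitary p.2.2 a i)).trans ?_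
  refine (norm_sum_le _ _).trans (Finset.sum_le_sum fun b _ => ?_)
  rw [norm_mul]
  exact mul_le_of_le_one_left (norm_nonneg _) (entry_norm_bound_of_unitary p.1.2 i b)

lemma diagSum_le_kyFanFun (k : ℕ) (X : SquareTensor I) {U V : SquareTensor I}
    (hU : U ∈ Matrix.unitaryGroup (MultiIndex I) ℂ)
    (hV : V ∈ Matrix.unitaryGroup (MultiIndex I) ℂ) :
    diagSum k (U * X * V) ≤ kyFanFun k X :=
  le_ciSup (bddAbove_diagSum k X) (⟨U, hU⟩, ⟨V, hV⟩)

lemma kyFanFun_unitary (k : ℕ) (X : SquareTensor I) {U V : SquareTensor I}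
    (hU : U ∈ Matrix.unitaryGroup (MultiIndex I) ℂ)
    (hV : V ∈ Matrix.unitaryGroup (MultiIndex I) ℂ) :
    kyFanFun k (U * X * V) ≤ kyFanFun k X := by
  refine ciSup_le fun p => ?_
  have h := diagSum_le_kyFanFun k X (mul_mem p.1.2 hU) (mul_mem hV p.2.2)
  simpa only [Matrix.mul_assoc] using h

/-- The Ky Fan `k`-norm as a seminorm. -/
noncomputable def kyFanSeminorm (I : Fin N → ℕ) (k : ℕ) : Seminorm ℂ (SquareTensor I) :=
  Seminorm.of (kyFanFun k)
    (fun X Y => by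
      refine ciSup_le fun p => ?_
      refine le_trans ?_ (add_le_add (diagSum_le_kyFanFun k X p.1.2 p.2.2)
        (diagSum_le_kyFanFun k Y p.1.2 p.2.2))
      rw [diagSum, diagSum, diagSum, ← Finset.sum_add_distrib, Matrix.mul_add, Matrix.add_mul]
      exact Finset.sum_le_sum fun i _ => norm_add_le _ _)
    (fun c X => by
      rw [kyFanFun, kyFanFun, Real.mul_iSup_of_nonneg (norm_nonneg c)]
      congr 1
      funext p
      rw [diagSum, diagSum, Finset.mul_sum, Matrix.mul_smul, Matrix.smul_mul]
      exact Finset.sum_congr rfl fun i _ => by rw [Matrix.smul_apply, norm_smul])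

/-- The Ky Fan `k`-norm for `k ≥ 1`. -/
noncomputable def kyFan (I : Fin N → ℕ) (k : ℕ) (hk : 1 ≤ k) : UnitarilyInvariantNorm I where
  toSeminorm := kyFanSeminorm I k
  eq_zero_of_map_eq_zero X hX := by
    change kyFanFun k X = 0 at hX
    ext a b
    have hr : 0 < tensorDim I := Fintype.card_pos_iff.2 ⟨a⟩
    set i₀ : MultiIndex I := (indexEquiv I).symm ⟨0, hr⟩ with hi₀
    -- The two swaps bring the entry (a, b) to the diagonal place of `i₀`, which is counted since k
    -- ≥ 1.
    have h := (diagSum_le_kyFanFun k X (permMatrix_mem_unitaryGroup (Equiv.swap i₀ a))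
      (permMatrix_mem_unitaryGroup (Equiv.swap i₀ b))).trans_eq hX
    rw [Equiv.Perm.permMatrix, Equiv.Perm.permMatrix, PEquiv.toMatrix_toPEquiv_mul,
      PEquiv.mul_toMatrix_toPEquiv] at h
    have h2 := (Finset.single_le_sum (fun i _ => norm_nonneg _)
      (Finset.mem_filter.2 ⟨Finset.mem_univ i₀, by
        rw [hi₀, Equiv.apply_symm_apply]
        exact hk⟩)).trans h
    simpa using h2
  unitary_mul U hU X := by
    change kyFanFun k (U * X) = kyFanFun k X
    have h1 := kyFanFun_unitary k X hU (one_mem _)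
    have h2 := kyFanFun_unitary k (U * X) (Unitary.star_mem hU) (one_mem _)
    rw [Matrix.mul_one] at h1 h2
    rw [← Matrix.mul_assoc, Matrix.mem_unitaryGroup_iff'.1 hU, Matrix.one_mul] at h2
    exact le_antisymm h1 h2
  mul_unitary U hU X := by
    change kyFanFun k (X * U) = kyFanFun k X
    have h1 := kyFanFun_unitary k X (one_mem _) hU
    have h2 := kyFanFun_unitary k (X * U) (one_mem _) (Unitary.star_mem hU)
    rw [Matrix.one_mul] at h1 h2
    rw [Matrix.mul_assoc, Matrix.mem_unitaryGroup_iff.1 hU, Matrix.mul_one] at h2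
    exact le_antisymm h1 h2

/-- Bathtub principle: with t the k-th largest entry of v, each product of v i - t with w i minus
the indicator of i < k is nonpositive. -/
lemma sum_mul_le_sum_of_antitone {r k : ℕ} (hk : 1 ≤ k) (hkr : k ≤ r) {v w : Fin r → ℝ}
    (hv : Antitone v) (hv0 : 0 ≤ v) (hw0 : 0 ≤ w) (hw1 : w ≤ 1) (hw : ∑ i, w i ≤ k) :
    ∑ i, v i * w i ≤ ∑ i with (Fin.val i) < k, v i := by
  set t := v ⟨k - 1, by omega⟩ with ht
  have hcard : ((Finset.univ.filter fun i : Fin r => i.val < k).card : ℝ) = k := by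
    rw [Fin.card_filter_val_lt, min_eq_right hkr]
  have h1 : ∑ i, (v i - t) * (w i - if i.val < k then 1 else 0) ≤ 0 := by
    refine Finset.sum_nonpos fun i _ => ?_
    split_ifs with hi
    · have : t ≤ v i := hv (Fin.le_def.2 (by simp only; omega))
      exact mul_nonpos_of_nonneg_of_nonpos (by linarith)
        (sub_nonpos.2 (hw1 i))
    · have : v i ≤ t := hv (Fin.le_def.2 (by simp only; omega))
      exact mul_nonpos_of_nonpos_of_nonneg (by linarith) (by simpa using hw0 i)
  have h2 : ∑ i, (v i - t) * (w i - if i.val < k then 1 else 0) =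
      ∑ i, v i * w i - ∑ i with (Fin.val i) < k, v i - t * (∑ i, w i - k) := by
    rw [← hcard, Finset.card_filter, Finset.sum_filter, mul_sub, Finset.mul_sum, Nat.cast_sum,
      Finset.mul_sum, ← Finset.sum_sub_distrib, ← Finset.sum_sub_distrib,
      ← Finset.sum_sub_distrib]
    refine Finset.sum_congr rfl fun i _ => ?_
    split_ifs <;> simp <;> ring
  have h3 : t * (∑ i, w i - k) ≤ 0 :=
    mul_nonpos_of_nonneg_of_nonpos (hv0 _) (by linarith)
  linarith

lemma sum_norm_sq_row {n : Type*} [Fintype n] [DecidableEq n] {U : Matrix n n ℂ}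
    (hU : U ∈ Matrix.unitaryGroup n ℂ) (i : n) : ∑ j, ‖U i j‖ ^ 2 = 1 := by
  have h := congrFun (congrFun (Matrix.mem_unitaryGroup_iff.1 hU) i) i
  rw [Matrix.mul_apply, Matrix.one_apply_eq] at h
  have h2 : ∀ j, U i j * (star U) j i = ((‖U i j‖ ^ 2 : ℝ) : ℂ) := fun j => by
    rw [Matrix.star_apply, ← starRingEnd_apply, Complex.mul_conj, Complex.normSq_eq_norm_sq]
  simp only [h2] at h
  exact_mod_cast h

lemma sum_norm_sq_col {n : Type*} [Fintype n] [DecidableEq n] {U : Matrix n n ℂ}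
    (hU : U ∈ Matrix.unitaryGroup n ℂ) (i : n) : ∑ j, ‖U j i‖ ^ 2 = 1 := by
  have h := sum_norm_sq_row (Unitary.star_mem hU) i
  simpa [Matrix.star_apply] using h

lemma gauge_kyFan {k : ℕ} (hk : 1 ≤ k) (hkr : k ≤ tensorDim I) {v : Fin (tensorDim I) → ℝ}
    (hv : Antitone v) (hv0 : 0 ≤ v) :
    (kyFan I k hk).gauge v = ∑ i with (Fin.val i) < k, v i := by
  have hreindex : ∀ f : Fin (tensorDim I) → ℝ,
      ∑ i with (indexEquiv I i).val < k, f (indexEquiv I i) = ∑ i with (Fin.val i) < k, f i := by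
    intro f
    rw [Finset.sum_filter, Finset.sum_filter]
    exact Equiv.sum_comp (indexEquiv I) fun i => if i.val < k then f i else 0
  set X : SquareTensor I := Matrix.diagonal fun i => (v (indexEquiv I i) : ℂ) with hX
  change kyFanFun k X = _
  refine le_antisymm (ciSup_le fun p => ?_) ?_
  · obtain ⟨⟨U, hU⟩, ⟨V, hV⟩⟩ := p
    simp only
    set S := Finset.univ.filter fun i : MultiIndex I => (indexEquiv I i).val < k with hS
    -- These weights come from |U i j| |V j i| ≤ (|U i j|² + |V j i|²) / 2. Unit rows and columns
    -- make each weight at most 1 and their total k.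
    set w : MultiIndex I → ℝ := fun j => ∑ i ∈ S, (‖U i j‖ ^ 2 + ‖V j i‖ ^ 2) / 2 with hw
    have hScard : (S.card : ℝ) = k := by
      have h := hreindex fun _ => 1
      rw [Finset.sum_const, Finset.sum_const, Fin.card_filter_val_lt, min_eq_right hkr] at h
      simpa using h
    have hle : diagSum k (U * X * V) ≤ ∑ j, v (indexEquiv I j) * w j := by
      have hterm : ∀ i, ‖(U * X * V) i i‖ ≤
          ∑ j, v (indexEquiv I j) * ((‖U i j‖ ^ 2 + ‖V j i‖ ^ 2) / 2) := by
        intro i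
        rw [hX, Matrix.mul_apply]
        refine (norm_sum_le _ _).trans (Finset.sum_le_sum fun j _ => ?_)
        rw [Matrix.mul_diagonal, norm_mul, norm_mul, Complex.norm_real,
          Real.norm_of_nonneg (hv0 _)]
        nlinarith [sq_nonneg (‖U i j‖ - ‖V j i‖), hv0 (indexEquiv I j),
          mul_nonneg (hv0 (indexEquiv I j)) (sq_nonneg (‖U i j‖ - ‖V j i‖))]
      refine (Finset.sum_le_sum fun i _ => hterm i).trans_eq ?_
      rw [Finset.sum_comm]
      exact Finset.sum_congr rfl fun j _ => by rw [hw, Finset.mul_sum]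
    refine hle.trans ?_
    have hsum := Equiv.sum_comp (indexEquiv I).symm fun j => v (indexEquiv I j) * w j
    rw [← hsum]
    simp only [Equiv.apply_symm_apply]
    refine sum_mul_le_sum_of_antitone hk hkr hv hv0 (fun i => ?_) (fun i => ?_) ?_
    · exact Finset.sum_nonneg fun _ _ => by positivity
    · refine (Finset.sum_le_sum_of_subset_of_nonneg (Finset.subset_univ S)
        fun _ _ _ => by positivity).trans_eq ?_
      rw [← Finset.sum_div, Finset.sum_add_distrib, sum_norm_sq_col hU, sum_norm_sq_row hV]
      norm_num
    · rw [Equiv.sum_comp (indexEquiv I).symm w, hw, Finset.sum_comm]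
      simp_rw [← Finset.sum_div, Finset.sum_add_distrib, sum_norm_sq_row hU, sum_norm_sq_col hV]
      rw [Finset.sum_const, nsmul_eq_mul, hScard]
      norm_num
  · have h := diagSum_le_kyFanFun k X (one_mem _) (one_mem _)
    refine le_trans (le_of_eq ?_) h
    rw [← hreindex, Matrix.one_mul, Matrix.mul_one]
    refine Finset.sum_congr rfl fun i _ => ?_
    rw [hX, Matrix.diagonal_apply_eq, Complex.norm_real, Real.norm_of_nonneg (hv0 _)]

lemma eigVec_antitone {A : SquareTensor I} (hA : A.IsHermitian) : Antitone (eigVec hA) :=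
  hA.eigenvalues₀_antitone

lemma eigVec_eq {A : SquareTensor I} (hA : A.IsHermitian) (k : Fin (tensorDim I)) :
    eigVec hA k = hA.eigenvalues ((indexEquiv I).symm k) := by
  rw [Matrix.IsHermitian.eigenvalues, eigVec]
  congr 1
  exact ((indexEquiv I).apply_symm_apply k).symm

lemma eigVec_nonneg {A : SquareTensor I} (hA : A.PosSemidef) : 0 ≤ eigVec hA.isHermitian :=
  fun k => (hA.eigenvalues_nonneg _).trans_eq (eigVec_eq hA.isHermitian k).symm

lemma UnitarilyInvariantNorm.map_eq_gauge (ρ : UnitarilyInvariantNorm I) {A : SquareTensor I}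
    (hA : A.IsHermitian) : ρ.toSeminorm A = ρ.gauge (eigVec hA) := by
  have h := ρ.map_cfc hA id
  rwa [← hA.cfc_eq, cfc_id ℝ A hA.isSelfAdjoint] at h

lemma UnitarilyInvariantNorm.continuous (ρ : UnitarilyInvariantNorm I) :
    Continuous ρ.toSeminorm := by
  have hbound : ∀ X, ρ.toSeminorm X ≤ ∑ i, ∑ j, ‖X i j‖ * ρ.toSeminorm (Matrix.single i j 1) := by
    intro X
    conv_lhs => rw [Matrix.matrix_eq_sum_single X]
    refine (Finset.le_sum_of_subadditive _ (map_zero ρ.toSeminorm).le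
      (map_add_le_add ρ.toSeminorm) _ _).trans (Finset.sum_le_sum fun i _ => ?_)
    refine (Finset.le_sum_of_subadditive _ (map_zero ρ.toSeminorm).le
      (map_add_le_add ρ.toSeminorm) _ _).trans (Finset.sum_le_sum fun j _ => ?_)
    rw [← map_smul_eq_mul, Matrix.smul_single, smul_eq_mul, mul_one]
  refine continuous_iff_continuousAt.2 fun X => ?_
  rw [ContinuousAt, tendsto_iff_dist_tendsto_zero]
  refine squeeze_zero (fun _ => dist_nonneg)
    (fun Y => (abs_sub_map_le_sub ρ.toSeminorm Y X).trans (hbound (Y - X))) ?_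
  have h : Continuous fun Y : SquareTensor I =>
      ∑ i, ∑ j, ‖(Y - X) i j‖ * ρ.toSeminorm (Matrix.single i j 1) := by
    simp only [Matrix.sub_apply]
    fun_prop
  simpa using h.tendsto X

/-- Each eigenvalue is a difference of consecutive Ky Fan norms, and norms are continuous. -/
lemma continuous_eigVec {Ω : Type*} [TopologicalSpace Ω] {D : Ω → SquareTensor I}
    (hD : ∀ τ, (D τ).PosSemidef) (hDcont : Continuous D) (k : Fin (tensorDim I)) :
    Continuous fun τ => eigVec (hD τ).isHermitian k := by
  have hsum : ∀ m : ℕ, m ≤ tensorDim I →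
      Continuous fun τ => ∑ i with (Fin.val i) < m, eigVec (hD τ).isHermitian i := by
    intro m hm
    rcases Nat.eq_zero_or_pos m with rfl | hm0
    · simpa using continuous_const
    · have h := (kyFan I m hm0).continuous.comp hDcont
      refine h.congr fun τ => ?_
      rw [Function.comp_apply, (kyFan I m hm0).map_eq_gauge (hD τ).isHermitian,
        gauge_kyFan hm0 hm (eigVec_antitone _) (eigVec_nonneg (hD τ))]
  refine ((hsum (k + 1) k.2).sub (hsum k k.2.le)).congr fun τ => ?_
  have : (Finset.univ.filter fun i : Fin (tensorDim I) => i.val < k + 1) =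
      insert k (Finset.univ.filter fun i : Fin (tensorDim I) => i.val < k) := by
    ext i
    simp [Fin.ext_iff]
    omega
  rw [this, Pi.sub_apply, Finset.sum_insert (by simp), add_sub_cancel_right]

lemma eigVec_le_frobNorm {A : SquareTensor I} (hA : A.PosSemidef) (k : Fin (tensorDim I)) :
    eigVec hA.isHermitian k ≤ frobNorm A := by
  rw [frobNorm]
  refine Real.le_sqrt_of_sq_le ?_
  have h1 : Aᴴ * A = hA.isHermitian.cfc fun x => x ^ 2 := by
    rw [← hA.isHermitian.cfc_eq, cfc_pow_id A 2 hA.isHermitian.isSelfAdjoint,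
      hA.isHermitian.eq, sq]
  have h2 : (Matrix.trace (Aᴴ * A)).re = ∑ i, hA.isHermitian.eigenvalues i ^ 2 := by
    rw [h1, Matrix.IsHermitian.cfc, Unitary.conjStarAlgAut_apply, Matrix.trace_mul_comm,
      ← Matrix.mul_assoc, Unitary.coe_star_mul_self, Matrix.one_mul, Matrix.trace_diagonal]
    simp [-Complex.ofReal_pow]
  rw [h2, eigVec_eq]
  exact Finset.single_le_sum (f := fun i => hA.isHermitian.eigenvalues i ^ 2)
    (fun i _ => sq_nonneg _) (Finset.mem_univ _)

end KyFan

/-! ### Extended real integrals and Jensen's inequality for log. -/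

section ExtendedIntegral

variable {Ω : Type*} [MeasurableSpace Ω] {ν : Measure Ω}

lemma ereal_integral_mono_ae {F G : Ω → EReal} (h : ∀ᵐ τ ∂ν, F τ ≤ G τ) :
    ereal_integral ν F ≤ ereal_integral ν G := by
  refine EReal.sub_le_sub ?_ ?_
  · exact EReal.coe_ennreal_le_coe_ennreal_iff.2 (lintegral_mono_ae
      (h.mono fun τ hτ => EReal.toENNReal_le_toENNReal hτ))
  · exact EReal.coe_ennreal_le_coe_ennreal_iff.2 (lintegral_mono_ae
      (h.mono fun τ hτ => EReal.toENNReal_le_toENNReal (EReal.neg_le_neg_iff.2 hτ)))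

lemma ereal_integral_congr_ae {F G : Ω → EReal} (h : ∀ᵐ τ ∂ν, F τ = G τ) :
    ereal_integral ν F = ereal_integral ν G :=
  le_antisymm (ereal_integral_mono_ae (h.mono fun _ hτ => hτ.le))
    (ereal_integral_mono_ae (h.mono fun _ hτ => hτ.ge))

lemma ereal_integral_coe {h : Ω → ℝ} (hh : Integrable h ν) :
    ereal_integral ν (fun τ => (h τ : EReal)) = ((∫ τ, h τ ∂ν : ℝ) : EReal) := by
  have hneg : ∫⁻ τ, ENNReal.ofReal (-h τ) ∂ν ≠ ∞ := hh.neg.lintegral_lt_top.ne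
  rw [integral_eq_lintegral_pos_part_sub_lintegral_neg_part hh, EReal.coe_sub,
    EReal.coe_ennreal_toReal hh.lintegral_lt_top.ne, EReal.coe_ennreal_toReal hneg, ereal_integral]
  simp [← EReal.coe_neg]

lemma expIntLog_mono_ae {f g : Ω → ℝ≥0∞} (h : ∀ᵐ τ ∂ν, f τ ≤ g τ) :
    expIntLog ν f ≤ expIntLog ν g :=
  EReal.exp_monotone (ereal_integral_mono_ae (h.mono fun _ hτ => ENNReal.log_monotone hτ))

lemma expIntLog_ofReal_exp {f : Ω → ℝ≥0∞} {h : Ω → ℝ} (hh : Integrable h ν)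
    (hf : ∀ᵐ τ ∂ν, f τ = ENNReal.ofReal (Real.exp (h τ))) :
    expIntLog ν f = ENNReal.ofReal (Real.exp (∫ τ, h τ ∂ν)) := by
  rw [expIntLog, ereal_integral_congr_ae (G := fun τ => (h τ : EReal)), ereal_integral_coe hh,
    EReal.exp_coe]
  filter_upwards [hf] with τ hτ
  rw [hτ, ENNReal.log_ofReal_of_pos (Real.exp_pos _), Real.log_exp]

/-- The tangent to log at the mean a gives log H ≤ H / a + log a - 1, whose right side has integral
log a. Integrability of log H is not needed. -/
lemma expIntLog_le_lintegral [IsProbabilityMeasure ν] {H : Ω → ℝ} (hH : Measurable H)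
    (hpos : ∀ᵐ τ ∂ν, 0 < H τ) :
    expIntLog ν (fun τ => ENNReal.ofReal (H τ)) ≤ ∫⁻ τ, ENNReal.ofReal (H τ) ∂ν := by
  by_cases htop : ∫⁻ τ, ENNReal.ofReal (H τ) ∂ν = ∞
  · rw [htop]
    exact le_top
  have hint : Integrable H ν :=
    (lintegral_ofReal_ne_top_iff_integrable hH.aestronglyMeasurable
      (hpos.mono fun _ h => h.le)).1 htop
  set a := ∫ τ, H τ ∂ν with ha
  have ha0 : 0 < a := by
    refine lt_of_le_of_ne (integral_nonneg_of_ae (hpos.mono fun _ h => h.le)) fun h0 => ?_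
    have hz := (integral_eq_zero_iff_of_nonneg_ae (hpos.mono fun _ h => h.le) hint).1 h0.symm
    obtain ⟨τ, h1, h2⟩ := (hpos.and hz).exists
    exact h1.ne' h2
  rw [← ofReal_integral_eq_lintegral_ofReal hint (hpos.mono fun _ h => h.le), ← ha]
  have hint2 : Integrable (fun τ => a⁻¹ * H τ + (Real.log a - 1)) ν :=
    (hint.const_mul _).add (integrable_const _)
  have h1 : expIntLog ν (fun τ => ENNReal.ofReal (Real.exp (a⁻¹ * H τ + (Real.log a - 1)))) =
      ENNReal.ofReal a := by
    rw [expIntLog_ofReal_exp hint2 (ae_of_all _ fun _ => rfl),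
      integral_add (hint.const_mul _) (integrable_const _), integral_const_mul, ← ha,
      inv_mul_cancel₀ ha0.ne']
    simp [Real.exp_log ha0]
  rw [← h1]
  refine expIntLog_mono_ae (hpos.mono fun τ hτ => ENNReal.ofReal_le_ofReal ?_)
  rw [← Real.log_le_iff_le_exp hτ]
  have h2 := Real.log_le_sub_one_of_pos (mul_pos (inv_pos.2 ha0) hτ)
  rw [Real.log_mul (inv_pos.2 ha0).ne' hτ.ne', Real.log_inv] at h2
  linarith

end ExtendedIntegral

/-! ### Majorization and symmetric convex functions. -/

section Schur

/-- Abel summation: the difference of the two sides is a sum of partial sums of d weighted by the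
drops l i - l (i + 1). -/
lemma last_mul_sum_le_sum_mul {l d : ℕ → ℝ} (n : ℕ) (hl : ∀ i < n, l (i + 1) ≤ l i)
    (hd : ∀ k ≤ n, 0 ≤ ∑ i ∈ Finset.range k, d i) :
    l n * ∑ i ∈ Finset.range (n + 1), d i ≤ ∑ i ∈ Finset.range (n + 1), l i * d i := by
  induction n with
  | zero => simp
  | succ n ih =>
    have h1 := ih (fun i hi => hl i (by omega)) fun k hk => hd k (by omega)
    have h2 := mul_le_mul_of_nonneg_right (hl n (by omega)) (hd (n + 1) le_rfl)
    rw [Finset.sum_range_succ d, Finset.sum_range_succ _ (n + 1), mul_add]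
    linarith

lemma sum_filter_val_lt_eq {r : ℕ} (d : Fin r → ℝ) {k : ℕ} (hk : k ≤ r) :
    ∑ i with (Fin.val i) < k, d i =
      ∑ i ∈ Finset.range k, if h : i < r then d ⟨i, h⟩ else 0 := by
  have hk' : (Finset.range r).filter (· < k) = Finset.range k := by
    ext i
    simp
    omega
  rw [← hk', Finset.sum_filter, Finset.sum_filter, ← Fin.sum_univ_eq_sum_range
    fun i => if i < k then (if h : i < r then d ⟨i, h⟩ else 0) else 0]
  simp

lemma sum_mul_nonneg_of_antitone {r : ℕ} {l d : Fin r → ℝ} (hl : Antitone l)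
    (hd : ∀ k, 1 ≤ k → k ≤ r → 0 ≤ ∑ i with (Fin.val i) < k, d i) (hd0 : ∑ i, d i = 0) :
    0 ≤ ∑ i, l i * d i := by
  obtain _ | n := r
  · simp
  have h := last_mul_sum_le_sum_mul (l := fun i => if h : i < n + 1 then l ⟨i, h⟩ else 0)
    (d := fun i => if h : i < n + 1 then d ⟨i, h⟩ else 0) n ?_ ?_
  · rw [← Fin.sum_univ_eq_sum_range, ← Fin.sum_univ_eq_sum_range] at h
    simpa only [Fin.is_lt, dite_true, Fin.eta, hd0, mul_zero] using h
  · intro i hi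
    rw [dif_pos (by omega), dif_pos (by omega)]
    exact hl (Fin.le_def.2 (by simp))
  · intro k hk
    rcases Nat.eq_zero_or_pos k with rfl | hk0
    · simp
    · rw [← sum_filter_val_lt_eq _ (by omega)]
      exact hd k hk0 (by omega)

variable {Ω : Type*} [MeasurableSpace Ω] {ν : Measure Ω} [IsProbabilityMeasure ν]

/-- A symmetric convex function, composed with a random vector whose mean majorizes `x`, has an
integrable minorant whose integral is almost the value at `x`. -/
lemma exists_integrable_minorant {r : ℕ} {F : (Fin r → ℝ) → ℝ} (hF : ConvexOn ℝ Set.univ F)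
    (hsymm : ∀ (σ : Equiv.Perm (Fin r)) (v : Fin r → ℝ), F (v ∘ σ) = F v) {x : Fin r → ℝ}
    (hx : Antitone x) {y : Ω → Fin r → ℝ} (hy : ∀ i, Integrable (fun τ => y τ i) ν)
    (hmaj : ∀ k, 1 ≤ k → k ≤ r →
      ∑ i with (Fin.val i) < k, x i ≤ ∑ i with (Fin.val i) < k, ∫ τ, y τ i ∂ν)
    (htot : ∑ i, x i = ∑ i, ∫ τ, y τ i ∂ν) {ε : ℝ} (hε : 0 < ε) :
    ∃ h : Ω → ℝ, Integrable h ν ∧ (∀ τ, h τ ≤ F (y τ)) ∧ F x - ε ≤ ∫ τ, h τ ∂ν := by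
  have hcont : ContinuousOn F Set.univ := hF.continuousOn isOpen_univ
  -- The loss ε comes from separating the point (x, F x - ε), strictly below the graph, from the
  -- epigraph of F.
  obtain ⟨L, c, hLle, hLx⟩ := hF.exists_affine_le_of_lt (𝕜 := ℝ) (Set.mem_univ x)
    (sub_lt_self (F x) hε) isClosed_univ hcont.lowerSemicontinuousOn
  set l : Fin r → ℝ := fun i => L (Pi.single i 1) with hl
  have hLsum : ∀ z : Fin r → ℝ, L z = ∑ i, l i * z i := by
    intro z
    conv_lhs => rw [← Finset.univ_sum_single z, map_sum]
    refine Finset.sum_congr rfl fun i _ => ?_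
    rw [hl, mul_comm, ← smul_eq_mul, ← map_smul, ← Pi.single_smul, smul_eq_mul, mul_one]
  have hle : ∀ z, ∑ i, l i * z i + c ≤ F z := fun z => by
    have := hLle ⟨z, trivial⟩
    simpa [hLsum] using this
  have hxeq : ∑ i, l i * x i + c = F x - ε := by
    simpa [hLsum] using hLx
  -- By symmetry of F the permuted functional is still a minorant. Decreasing coefficients are what
  -- makes it monotone under majorization.
  set σ := Tuple.sort (-l) with hσ
  have hanti : Antitone (l ∘ σ) := by
    intro i j hij
    have := Tuple.monotone_sort (-l) hij
    simpa using this
  refine ⟨fun τ => ∑ i, (l ∘ σ) i * y τ i + c, ?_, fun τ => ?_, ?_⟩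
  · exact (integrable_finsetSum _ fun i _ => (hy i).const_mul _).add (integrable_const _)
  · rw [← hsymm σ⁻¹ (y τ)]
    refine le_trans (le_of_eq ?_) (hle _)
    rw [← Equiv.sum_comp σ]
    simp
  · rw [integral_add (integrable_finsetSum _ fun i _ => (hy i).const_mul _) (integrable_const _),
      integral_finsetSum _ fun i _ => (hy i).const_mul _, ← hxeq]
    simp only [integral_const_mul, integral_const, probReal_univ, one_smul]
    -- Rearrangement inequality: sorting l to match the order of x can only raise the value at x.
    have h1 : ∑ i, l i * x i ≤ ∑ i, (l ∘ σ) i * x i := by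
      have hmono : Monovary (l ∘ σ) x := hanti.monovary hx
      have := hmono.sum_comp_perm_mul_le_sum_mul (σ := σ⁻¹)
      simpa using this
    have h2 : 0 ≤ ∑ i, (l ∘ σ) i * (∫ τ, y τ i ∂ν - x i) := by
      refine sum_mul_nonneg_of_antitone hanti (fun k hk hkr => ?_) ?_
      · rw [Finset.sum_sub_distrib]
        exact sub_nonneg.2 (hmaj k hk hkr)
      · rw [Finset.sum_sub_distrib, htot, sub_self]
    simp only [mul_sub, Finset.sum_sub_distrib] at h2
    linarith

end Schur

/-! ### Norms of functions of invertible and singular tensors. -/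

section NormFun

variable {N : ℕ} {I : Fin N → ℕ} (ρ : UnitarilyInvariantNorm I)

lemma UnitarilyInvariantNorm.continuous_gauge : Continuous ρ.gauge := by
  refine ρ.continuous.comp (Continuous.matrix_diagonal ?_)
  fun_prop

lemma UnitarilyInvariantNorm.normFun_of_pos {f : ℝ → ℝ} (hf : ∀ x, 0 < x → 0 ≤ f x)
    {A : SquareTensor I} (hA : A.PosSemidef) (hpos : ∀ k, 0 < eigVec hA.isHermitian k) :
    ρ.normFun f hA = ENNReal.ofReal (ρ.gauge fun k => f (eigVec hA.isHermitian k)) := by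
  have h : ∀ k, extendZero f (eigVec hA.isHermitian k) =
      ENNReal.ofReal (f (eigVec hA.isHermitian k)) := fun k => if_pos (hpos k)
  rw [normFun, if_neg (by simp [h]), ρ.map_cfc]
  simp only [h, ENNReal.toReal_ofReal (hf _ (hpos _))]

lemma UnitarilyInvariantNorm.normFun_rpow_neg_eq_top {p : ℝ} (hp : 0 < p) {A : SquareTensor I}
    (hA : A.PosSemidef) {k : Fin (tensorDim I)} (hk : eigVec hA.isHermitian k = 0) :
    ρ.normFun (fun x => x ^ (-p)) hA = ∞ := by
  refine if_pos ⟨k, ?_⟩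
  rw [extendZero, if_neg (by rw [hk]; exact lt_irrefl 0)]
  exact (ENNReal.tendsto_ofReal_atTop.comp
    (tendsto_rpow_neg_nhdsGT_zero (neg_lt_zero.2 hp))).limUnder_eq

/-- Negative powers reverse the order of eigenvalues; reversing it back does not change a sum over
all indices. -/
lemma gauge_kyFan_of_monotone (hr : 1 ≤ tensorDim I) {v : Fin (tensorDim I) → ℝ}
    (hv : Monotone v) (hv0 : 0 ≤ v) :
    (kyFan I (tensorDim I) hr).gauge v = ∑ i, v i := by
  rw [← (kyFan I (tensorDim I) hr).gauge_comp_perm Fin.revPerm, gauge_kyFan hr le_rfl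
    (v := v ∘ Fin.revPerm) (fun i j hij => hv (Fin.rev_le_rev.2 hij))
    (fun i => hv0 (Fin.revPerm i))]
  simp only [Fin.is_lt, Finset.filter_true]
  exact Equiv.sum_comp Fin.revPerm v

end NormFun

/-! ### The limit of small exponents. -/

section PowerLimit

variable {Ω : Type*} [MeasurableSpace Ω] {ν : Measure Ω} [IsProbabilityMeasure ν]

/-- Secant slopes at 0 of the convex function q ↦ e^{qz} increase with q. This supplies the
dominating function for the limit q ↓ 0. -/
lemma exp_mul_le_interp {p q z : ℝ} (hq : 0 < q) (hqp : q ≤ p) :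
    (Real.exp (q * z) - 1) / q ≤ (Real.exp (p * z) - 1) / p := by
  have hp : 0 < p := hq.trans_le hqp
  have h := convexOn_exp.2 (Set.mem_univ (p * z)) (Set.mem_univ 0) (div_nonneg hq.le hp.le)
    (sub_nonneg.2 ((div_le_one hp).2 hqp)) (by ring)
  simp only [smul_eq_mul, mul_zero, add_zero, Real.exp_zero, mul_one] at h
  rw [show q / p * (p * z) = q * z by field_simp] at h
  rw [div_le_iff₀ hq]
  have : (Real.exp (p * z) - 1) / p * q = q / p * Real.exp (p * z) + (1 - q / p) - 1 := by ring
  linarith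

lemma le_exp_mul_sub_one_div {q : ℝ} (hq : 0 < q) (z : ℝ) : z ≤ (Real.exp (q * z) - 1) / q := by
  rw [le_div_iff₀ hq]
  linarith [Real.add_one_le_exp (q * z)]

lemma integrable_exp_mul_of_le {z : Ω → ℝ} (hz : Integrable z ν) {p q : ℝ}
    (hexp : Integrable (fun τ => Real.exp (p * z τ)) ν) (hq : 0 < q) (hqp : q ≤ p) :
    Integrable (fun τ => Real.exp (q * z τ)) ν := by
  have hp : 0 < p := hq.trans_le hqp
  refine ((((hexp.sub (integrable_const 1)).div_const p).mul_const q).add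
    (integrable_const 1)).mono' (Real.continuous_exp.comp_aestronglyMeasurable
      (hz.const_mul q).aestronglyMeasurable) (ae_of_all _ fun τ => ?_)
  rw [Real.norm_of_nonneg (Real.exp_pos _).le]
  have h := (div_le_iff₀ hq).1 (exp_mul_le_interp (z := z τ) hq hqp)
  simpa using by linarith

lemma tendsto_integral_exp_mul_sub_one_div {z : Ω → ℝ} (hz : Integrable z ν) {p : ℝ} (hp : 0 < p)
    (hexp : Integrable (fun τ => Real.exp (p * z τ)) ν) :
    Tendsto (fun q : ℝ => ∫ τ, (Real.exp (q * z τ) - 1) / q ∂ν) (𝓝[>] 0) (𝓝 (∫ τ, z τ ∂ν)) := by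
  refine tendsto_integral_filter_of_dominated_convergence
    (fun τ => |z τ| + |(Real.exp (p * z τ) - 1) / p|) ?_ ?_ ?_ ?_
  · exact Eventually.of_forall fun q => ((((hz.aestronglyMeasurable.aemeasurable.const_mul
      q).exp).sub_const 1).div_const q).aestronglyMeasurable
  · filter_upwards [Ioc_mem_nhdsGT hp] with q hq
    refine ae_of_all _ fun τ => abs_le.2 ⟨?_, ?_⟩
    · have := le_exp_mul_sub_one_div hq.1 (z τ)
      linarith [neg_abs_le (z τ), abs_nonneg ((Real.exp (p * z τ) - 1) / p)]
    · have := exp_mul_le_interp (z := z τ) hq.1 hq.2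
      linarith [le_abs_self ((Real.exp (p * z τ) - 1) / p), abs_nonneg (z τ)]
  · exact hz.abs.add ((hexp.sub (integrable_const 1)).div_const p).abs
  · refine ae_of_all _ fun τ => ?_
    have h : HasDerivAt (fun q : ℝ => Real.exp (q * z τ)) (z τ) 0 := by
      simpa using ((hasDerivAt_id (0 : ℝ)).mul_const (z τ)).exp
    have h2 := (hasDerivAt_iff_tendsto_slope_zero.1 h).mono_left
      (nhdsWithin_mono 0 fun q (hq : 0 < q) => hq.ne')
    refine h2.congr fun q => ?_
    simp [div_eq_inv_mul]

lemma sum_le_sum_integral_of_exp_le {r : ℕ} {a : Fin r → ℝ} {z : Ω → Fin r → ℝ}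
    (S : Finset (Fin r)) (hz : ∀ i, Integrable (fun τ => z τ i) ν) {p : ℝ} (hp : 0 < p)
    (hexp : ∀ i, Integrable (fun τ => Real.exp (p * z τ i)) ν)
    (h : ∀ q, 0 < q → q ≤ p →
      ∑ i ∈ S, Real.exp (q * a i) ≤ ∑ i ∈ S, ∫ τ, Real.exp (q * z τ i) ∂ν) :
    ∑ i ∈ S, a i ≤ ∑ i ∈ S, ∫ τ, z τ i ∂ν := by
  refine ge_of_tendsto (tendsto_finsetSum S fun i _ =>
    tendsto_integral_exp_mul_sub_one_div (hz i) hp (hexp i)) ?_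
  filter_upwards [Ioc_mem_nhdsGT hp] with q hq
  calc ∑ i ∈ S, a i ≤ ∑ i ∈ S, (Real.exp (q * a i) - 1) / q :=
        Finset.sum_le_sum fun i _ => le_exp_mul_sub_one_div hq.1 _
    _ = (∑ i ∈ S, Real.exp (q * a i) - ∑ i ∈ S, 1) / q := by
        rw [← Finset.sum_sub_distrib, Finset.sum_div]
    _ ≤ (∑ i ∈ S, ∫ τ, Real.exp (q * z τ i) ∂ν - ∑ i ∈ S, 1) / q :=
        div_le_div_of_nonneg_right (sub_le_sub_right (h q hq.1 hq.2) _) hq.1.le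
    _ = ∑ i ∈ S, ∫ τ, (Real.exp (q * z τ i) - 1) / q ∂ν := by
        rw [← Finset.sum_sub_distrib, Finset.sum_div]
        refine Finset.sum_congr rfl fun i _ => ?_
        rw [integral_div, integral_sub (integrable_exp_mul_of_le (hz i) (hexp i) hq.1 hq.2)
          (integrable_const _)]
        simp

end PowerLimit

/-! ### Integrability of the logarithms of eigenvalues. -/

section Families

variable {Ω : Type*} [MeasurableSpace Ω] {ν : Measure Ω} {N : ℕ} {I : Fin N → ℕ}
  {D : Ω → SquareTensor I}

/-- By monotonicity the gauge dominates its value on a single coordinate, so the moment condition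
passes from the norm to each eigenvalue. Singular tensors contribute ∞ to the norm. -/
lemma lintegral_eigVec_rpow_neg_lt_top (hD : ∀ τ, (D τ).PosSemidef)
    (ρ : UnitarilyInvariantNorm I) {p : ℝ} (hp : 0 < p)
    (hDp : ∫⁻ τ, ρ.normFun (fun x => x ^ (-p)) (hD τ) ∂ν < ∞) (k : Fin (tensorDim I)) :
    ∫⁻ τ, ENNReal.ofReal (eigVec (hD τ).isHermitian k) ^ (-p) ∂ν < ∞ := by
  set c := ρ.gauge (Pi.single k 1) with hc
  have hc0 : 0 < c := ρ.gauge_pos (by simp)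
  have hle : ∀ τ, ENNReal.ofReal c * ENNReal.ofReal (eigVec (hD τ).isHermitian k) ^ (-p) ≤
      ρ.normFun (fun x => x ^ (-p)) (hD τ) := by
    intro τ
    by_cases h : ∃ j, eigVec (hD τ).isHermitian j = 0
    · obtain ⟨j, hj⟩ := h
      rw [ρ.normFun_rpow_neg_eq_top hp (hD τ) hj]
      exact le_top
    · push Not at h
      have hpos : ∀ j, 0 < eigVec (hD τ).isHermitian j := fun j =>
        lt_of_le_of_ne (eigVec_nonneg (hD τ) j) (h j).symm
      rw [ρ.normFun_of_pos (fun x hx => Real.rpow_nonneg hx.le _) (hD τ) hpos,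
        ENNReal.ofReal_rpow_of_pos (hpos k), ← ENNReal.ofReal_mul hc0.le, mul_comm, hc,
        ← ρ.gauge_smul (Real.rpow_nonneg (hpos k).le _)]
      refine ENNReal.ofReal_le_ofReal (ρ.gauge_mono (fun j => ?_) fun j => ?_)
      · by_cases hj : j = k
        · subst hj
          simpa using Real.rpow_nonneg (hpos j).le _
        · simp [hj]
      · by_cases hj : j = k
        · subst hj
          simp
        · simpa [hj] using Real.rpow_nonneg (hpos j).le _
  have h1 := (lintegral_mono hle).trans_lt hDp
  rw [lintegral_const_mul' _ _ ENNReal.ofReal_ne_top] at h1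
  exact ENNReal.lt_top_of_mul_ne_top_right h1.ne (ENNReal.ofReal_pos.2 hc0).ne'

/-- The integrability properties of the logarithms of the eigenvalues. -/
structure LogIntegrable (ν : Measure Ω) (hD : ∀ τ, (D τ).PosSemidef) (p : ℝ) : Prop where
  measurable : ∀ k, Measurable fun τ => eigVec (hD τ).isHermitian k
  pos : ∀ᵐ τ ∂ν, ∀ k, 0 < eigVec (hD τ).isHermitian k
  log : ∀ k, Integrable (fun τ => Real.log (eigVec (hD τ).isHermitian k)) ν
  exp : ∀ k, Integrable (fun τ => Real.exp (p * Real.log (eigVec (hD τ).isHermitian k))) ν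
  exp_neg : ∀ k,
    Integrable (fun τ => Real.exp (p * -Real.log (eigVec (hD τ).isHermitian k))) ν

lemma logIntegrable [TopologicalSpace Ω] [BorelSpace Ω] [IsProbabilityMeasure ν]
    (hD : ∀ τ, (D τ).PosSemidef) (hDcont : Continuous D)
    (hDbdd : BddAbove (Set.range fun τ => frobNorm (D τ)))
    (ρ : UnitarilyInvariantNorm I) {p : ℝ} (hp : 0 < p)
    (hDp : ∫⁻ τ, ρ.normFun (fun x => x ^ (-p)) (hD τ) ∂ν < ∞) : LogIntegrable ν hD p := by
  have hmeas : ∀ k, Measurable fun τ => eigVec (hD τ).isHermitian k := fun k =>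
    (continuous_eigVec hD hDcont k).measurable
  have hfin := lintegral_eigVec_rpow_neg_lt_top hD ρ hp hDp
  have hpos : ∀ᵐ τ ∂ν, ∀ k, 0 < eigVec (hD τ).isHermitian k := by
    refine ae_all_iff.2 fun k => ?_
    filter_upwards [ae_lt_top ((hmeas k).ennreal_ofReal.pow_const _) (hfin k).ne] with τ hτ
    by_contra h
    rw [ENNReal.ofReal_eq_zero.2 (not_lt.1 h), ENNReal.zero_rpow_of_neg (neg_lt_zero.2 hp)] at hτ
    exact lt_irrefl _ hτ
  obtain ⟨M, hM⟩ := hDbdd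
  have hlogmeas : ∀ k, Measurable fun τ => Real.log (eigVec (hD τ).isHermitian k) := fun k =>
    (hmeas k).log
  have hle : ∀ τ k, eigVec (hD τ).isHermitian k ≤ M := fun τ k =>
    (eigVec_le_frobNorm (hD τ) k).trans (hM ⟨τ, rfl⟩)
  have hexp : ∀ k,
      Integrable (fun τ => Real.exp (p * Real.log (eigVec (hD τ).isHermitian k))) ν := by
    intro k
    refine (integrable_const (Real.exp (p * Real.log M))).mono'
      ((hlogmeas k).const_mul p).exp.aestronglyMeasurable ?_
    filter_upwards [hpos] with τ hτ
    rw [Real.norm_of_nonneg (Real.exp_pos _).le, Real.exp_le_exp]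
    exact mul_le_mul_of_nonneg_left (Real.log_le_log (hτ k) (hle τ k)) hp.le
  have hexpn : ∀ k,
      Integrable (fun τ => Real.exp (p * -Real.log (eigVec (hD τ).isHermitian k))) ν := by
    intro k
    refine (lintegral_ofReal_ne_top_iff_integrable
      ((hlogmeas k).neg.const_mul p).exp.aestronglyMeasurable
      (ae_of_all _ fun τ => (Real.exp_pos _).le)).1 ?_
    refine ne_of_eq_of_ne (lintegral_congr_ae ?_) (hfin k).ne
    filter_upwards [hpos] with τ hτ
    rw [ENNReal.ofReal_rpow_of_pos (hτ k), Real.rpow_def_of_pos (hτ k)]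
    simp only [Pi.neg_apply, mul_neg]
    rw [mul_comm]
  refine ⟨hmeas, hpos, fun k => ?_, hexp, hexpn⟩
  refine (((hexp k).add (hexpn k)).div_const p).mono' (hlogmeas k).aestronglyMeasurable
    (ae_of_all _ fun τ => ?_)
  -- The bound is p|t| ≤ e^{pt} + e^{-pt}.
  set t := Real.log (eigVec (hD τ).isHermitian k)
  have h1 := Real.add_one_le_exp (p * t)
  have h2 := Real.add_one_le_exp (p * -t)
  have h3 := Real.exp_pos (p * t)
  have h4 := Real.exp_pos (p * -t)
  simp only [Pi.add_apply]
  rw [le_div_iff₀ hp, Real.norm_eq_abs]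
  rcases abs_cases t with ⟨h, _⟩ | ⟨h, _⟩ <;> rw [h] <;> linarith

end Families

/-! ### The implications between the three statements. -/

section LogMajorization

lemma logMajorizedBy_ofReal_exp_iff {r : ℕ} {x m : Fin r → ℝ} :
    LogMajorizedBy (fun i => ENNReal.ofReal (Real.exp (x i)))
      (fun i => ENNReal.ofReal (Real.exp (m i))) ↔
    (∀ k : ℕ, 1 ≤ k → k ≤ r →
      ∑ i with (Fin.val i) < k, x i ≤ ∑ i with (Fin.val i) < k, m i) ∧ ∑ i, x i = ∑ i, m i := by
  have hprod : ∀ (S : Finset (Fin r)) (v : Fin r → ℝ),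
      ∏ i ∈ S, ENNReal.ofReal (Real.exp (v i)) = ENNReal.ofReal (Real.exp (∑ i ∈ S, v i)) := by
    intro S v
    rw [Real.exp_sum, ENNReal.ofReal_prod_of_nonneg fun i _ => (Real.exp_pos _).le]
  simp only [LogMajorizedBy, hprod, ENNReal.ofReal_le_ofReal_iff (Real.exp_pos _).le,
    Real.exp_le_exp, ENNReal.ofReal_eq_ofReal_iff (Real.exp_pos _).le (Real.exp_pos _).le,
    Real.exp_injective.eq_iff]

variable {Ω : Type*} [MeasurableSpace Ω] {ν : Measure Ω} {N : ℕ} {I : Fin N → ℕ}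
  {C : SquareTensor I} {D : Ω → SquareTensor I} {p : ℝ}

lemma LogIntegrable.expIntLog_eigVec {hD : ∀ τ, (D τ).PosSemidef} (hL : LogIntegrable ν hD p)
    (k : Fin (tensorDim I)) :
    expIntLog ν (fun τ => ENNReal.ofReal (eigVec (hD τ).isHermitian k)) =
      ENNReal.ofReal (Real.exp (∫ τ, Real.log (eigVec (hD τ).isHermitian k) ∂ν)) := by
  refine expIntLog_ofReal_exp (hL.log k) ?_
  filter_upwards [hL.pos] with τ hτ
  rw [Real.exp_log (hτ k)]

lemma logMajorizedBy_iff (hC : C.PosSemidef) {hD : ∀ τ, (D τ).PosSemidef}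
    (hL : LogIntegrable ν hD p) :
    LogMajorizedBy (fun i => ENNReal.ofReal (eigVec hC.isHermitian i))
      (fun i => expIntLog ν fun τ => ENNReal.ofReal (eigVec (hD τ).isHermitian i)) ↔
    (∀ k, 0 < eigVec hC.isHermitian k) ∧
    (∀ k : ℕ, 1 ≤ k → k ≤ tensorDim I →
      ∑ i with (Fin.val i) < k, Real.log (eigVec hC.isHermitian i) ≤
        ∑ i with (Fin.val i) < k, ∫ τ, Real.log (eigVec (hD τ).isHermitian i) ∂ν) ∧
    ∑ i, Real.log (eigVec hC.isHermitian i) =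
      ∑ i, ∫ τ, Real.log (eigVec (hD τ).isHermitian i) ∂ν := by
  simp only [hL.expIntLog_eigVec]
  have key : (∀ k, 0 < eigVec hC.isHermitian k) →
      (fun i => ENNReal.ofReal (eigVec hC.isHermitian i)) =
        fun i => ENNReal.ofReal (Real.exp (Real.log (eigVec hC.isHermitian i))) := fun h =>
    funext fun i => by rw [Real.exp_log (h i)]
  constructor
  · intro h
    -- Equality of the full products forces this, since the right-hand product is positive.
    have hpos : ∀ k, 0 < eigVec hC.isHermitian k := by
      intro k
      have h0 : ∏ i, ENNReal.ofReal (eigVec hC.isHermitian i) ≠ 0 := by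
        rw [h.2]
        exact Finset.prod_ne_zero_iff.2 fun i _ => (ENNReal.ofReal_pos.2 (Real.exp_pos _)).ne'
      exact ENNReal.ofReal_pos.1 (pos_iff_ne_zero.2 (Finset.prod_ne_zero_iff.1 h0 k
        (Finset.mem_univ k)))
    refine ⟨hpos, ?_⟩
    rwa [key hpos, logMajorizedBy_ofReal_exp_iff] at h
  · rintro ⟨hpos, h⟩
    rwa [key hpos, logMajorizedBy_ofReal_exp_iff]

lemma logConvexExp_rpow (q : ℝ) : LogConvexExp fun x => x ^ q := by
  intro x y a b _ _ _
  simp only [ENNReal.log_ofReal_of_pos (Real.rpow_pos_of_pos (Real.exp_pos _) q),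
    Real.log_rpow (Real.exp_pos _), Real.log_exp]
  norm_cast
  exact le_of_eq (by ring)

lemma isContNonneg_rpow (q : ℝ) : IsContNonneg fun x => x ^ q :=
  ⟨fun x hx => (Real.continuousAt_rpow_const x q (Or.inl (ne_of_gt hx))).continuousWithinAt,
    fun _ hx => Real.rpow_nonneg hx.le q⟩

/-- The set `S` serves both signs: the first k indices when q > 0, all indices when q < 0. -/
lemma sum_exp_le_of_normFun_le (hC : C.PosSemidef) {hD : ∀ τ, (D τ).PosSemidef}
    (hL : LogIntegrable ν hD p) (hpos : ∀ k, 0 < eigVec hC.isHermitian k)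
    (ρ : UnitarilyInvariantNorm I) {q : ℝ} {S : Finset (Fin (tensorDim I))}
    (hS : ∀ v : Fin (tensorDim I) → ℝ, Antitone v → (∀ i, 0 < v i) →
      ρ.gauge (fun i => v i ^ q) = ∑ i ∈ S, v i ^ q)
    (hint : ∀ i, Integrable (fun τ => Real.exp (q * Real.log (eigVec (hD τ).isHermitian i))) ν)
    (h : ρ.normFun (fun x => x ^ q) hC ≤ ∫⁻ τ, ρ.normFun (fun x => x ^ q) (hD τ) ∂ν) :
    ∑ i ∈ S, Real.exp (q * Real.log (eigVec hC.isHermitian i)) ≤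
      ∑ i ∈ S, ∫ τ, Real.exp (q * Real.log (eigVec (hD τ).isHermitian i)) ∂ν := by
  have hval : ∀ {A : SquareTensor I} (hA : A.PosSemidef), (∀ k, 0 < eigVec hA.isHermitian k) →
      ρ.normFun (fun x => x ^ q) hA =
        ENNReal.ofReal (∑ i ∈ S, Real.exp (q * Real.log (eigVec hA.isHermitian i))) := by
    intro A hA hApos
    rw [ρ.normFun_of_pos (isContNonneg_rpow q).2 hA hApos, hS _ (eigVec_antitone _) hApos]
    simp only [Real.rpow_def_of_pos (hApos _), mul_comm q]
  rw [hval hC hpos, lintegral_congr_ae (hL.pos.mono fun τ hτ => hval (hD τ) hτ),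
    ← ofReal_integral_eq_lintegral_ofReal (integrable_finsetSum _ fun i _ => hint i)
      (ae_of_all _ fun τ => Finset.sum_nonneg fun i _ => (Real.exp_pos _).le),
    integral_finsetSum _ fun i _ => hint i] at h
  exact (ENNReal.ofReal_le_ofReal_iff (Finset.sum_nonneg fun i _ =>
    integral_nonneg fun τ => (Real.exp_pos _).le)).1 h

variable [IsProbabilityMeasure ν]

lemma LogIntegrable.exists_minorant (hC : C.PosSemidef) {hD : ∀ τ, (D τ).PosSemidef}
    (hL : LogIntegrable ν hD p)
    (hmaj : LogMajorizedBy (fun i => ENNReal.ofReal (eigVec hC.isHermitian i))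
      (fun i => expIntLog ν fun τ => ENNReal.ofReal (eigVec (hD τ).isHermitian i)))
    {F : (Fin (tensorDim I) → ℝ) → ℝ} (hF : ConvexOn ℝ Set.univ F)
    (hsymm : ∀ (σ : Equiv.Perm (Fin (tensorDim I))) (v : Fin (tensorDim I) → ℝ),
      F (v ∘ σ) = F v) {ε : ℝ} (hε : 0 < ε) :
    ∃ h : Ω → ℝ, Integrable h ν ∧
      (∀ τ, h τ ≤ F fun i => Real.log (eigVec (hD τ).isHermitian i)) ∧
      F (fun i => Real.log (eigVec hC.isHermitian i)) - ε ≤ ∫ τ, h τ ∂ν := by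
  obtain ⟨hpos, hle, htot⟩ := (logMajorizedBy_iff hC hL).1 hmaj
  exact exists_integrable_minorant hF hsymm
    (fun i j hij => Real.log_le_log (hpos j) (eigVec_antitone _ hij)) hL.log hle htot hε

lemma tendsto_sub_nhdsGT_zero (a : ℝ) :
    Tendsto (fun ε : ℝ => a - ε) (𝓝[>] 0) (𝓝 a) := by
  have h : Tendsto (fun ε : ℝ => a - ε) (𝓝 0) (𝓝 (a - 0)) := tendsto_const_nhds.sub tendsto_id
  rw [sub_zero] at h
  exact h.mono_left nhdsWithin_le_nhds

lemma normFun_le_lintegral (hC : C.PosSemidef) {hD : ∀ τ, (D τ).PosSemidef}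
    (hL : LogIntegrable ν hD p)
    (hmaj : LogMajorizedBy (fun i => ENNReal.ofReal (eigVec hC.isHermitian i))
      (fun i => expIntLog ν fun τ => ENNReal.ofReal (eigVec (hD τ).isHermitian i)))
    (ρ : UnitarilyInvariantNorm I) {g : ℝ → ℝ} (hg : IsContNonneg g)
    (hconv : ConvexOn ℝ Set.univ (fun x : ℝ => g (Real.exp x))) :
    ρ.normFun g hC ≤ ∫⁻ τ, ρ.normFun g (hD τ) ∂ν := by
  have hpos := ((logMajorizedBy_iff hC hL).1 hmaj).1
  set F : (Fin (tensorDim I) → ℝ) → ℝ := fun x => ρ.gauge fun k => g (Real.exp (x k)) with hF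
  have hFlog : ∀ v : Fin (tensorDim I) → ℝ, (∀ i, 0 < v i) →
      F (fun i => Real.log (v i)) = ρ.gauge fun i => g (v i) := by
    intro v hv
    simp only [hF, Real.exp_log (hv _)]
  rw [ρ.normFun_of_pos hg.2 hC hpos, ← hFlog _ hpos]
  refine le_of_tendsto ((ENNReal.continuous_ofReal.tendsto _).comp (tendsto_sub_nhdsGT_zero _)) ?_
  filter_upwards [self_mem_nhdsWithin] with ε hε
  obtain ⟨h, hint, hle, hval⟩ := hL.exists_minorant hC hmaj (F := F)
    (ρ.convexOn_gauge_comp (fun t => hg.2 _ (Real.exp_pos t)) hconv)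
    (fun σ v => ρ.gauge_comp_perm σ fun k => g (Real.exp (v k))) hε
  have h1 : ∫ τ, h τ ∂ν ≤ (∫⁻ τ, ENNReal.ofReal (h τ) ∂ν).toReal := by
    rw [integral_eq_lintegral_pos_part_sub_lintegral_neg_part hint]
    exact sub_le_self _ ENNReal.toReal_nonneg
  refine (ENNReal.ofReal_le_of_le_toReal (hval.trans h1)).trans (lintegral_mono_ae ?_)
  filter_upwards [hL.pos] with τ hτ
  rw [ρ.normFun_of_pos hg.2 (hD τ) hτ, ← hFlog _ hτ]
  exact ENNReal.ofReal_le_ofReal (hle τ)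

/-- If f vanishes at y, then log x is the midpoint of log y and its reflection in log x, and
convexity bounds log f(x) by -∞. -/
lemma LogConvexExp.eq_zero_or_pos {f : ℝ → ℝ} (hf : IsContNonneg f) (hlog : LogConvexExp f) :
    (∀ x, 0 < x → f x = 0) ∨ ∀ x, 0 < x → 0 < f x := by
  by_contra! h
  obtain ⟨⟨x, hx, hfx⟩, y, hy, hfy⟩ := h
  have hy0 : f y = 0 := le_antisymm hfy (hf.2 y hy)
  have h1 := hlog (Real.log y) (2 * Real.log x - Real.log y) (1 / 2) (1 / 2) (by norm_num)
    (by norm_num) (by norm_num)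
  rw [show 1 / 2 * Real.log y + 1 / 2 * (2 * Real.log x - Real.log y) = Real.log x by ring,
    Real.exp_log hx, Real.exp_log hy, hy0, ENNReal.ofReal_zero, ENNReal.log_zero,
    EReal.coe_mul_bot_of_pos (by norm_num), EReal.bot_add, le_bot_iff, ENNReal.log_eq_bot_iff,
    ENNReal.ofReal_eq_zero] at h1
  exact hfx (le_antisymm h1 (hf.2 x hx))

lemma LogConvexExp.convexOn_log {f : ℝ → ℝ} (hlog : LogConvexExp f)
    (hpos : ∀ x, 0 < x → 0 < f x) :
    ConvexOn ℝ Set.univ fun x : ℝ => Real.log (f (Real.exp x)) := by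
  refine convexOn_iff_forall_pos.2 ⟨convex_univ, fun x _ y _ a b ha hb hab => ?_⟩
  have h := hlog x y a b ha hb hab
  simp only [ENNReal.log_ofReal_of_pos (hpos _ (Real.exp_pos _))] at h
  exact_mod_cast h

lemma convexOn_rpow_exp (q : ℝ) : ConvexOn ℝ Set.univ fun x : ℝ => Real.exp x ^ q := by
  have h := convexOn_exp.comp_linearMap (LinearMap.mulRight ℝ q)
  simpa [Function.comp_def, ← Real.exp_mul] using h

lemma normFun_le_expIntLog (hC : C.PosSemidef) {hD : ∀ τ, (D τ).PosSemidef}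
    (hL : LogIntegrable ν hD p)
    (hmaj : LogMajorizedBy (fun i => ENNReal.ofReal (eigVec hC.isHermitian i))
      (fun i => expIntLog ν fun τ => ENNReal.ofReal (eigVec (hD τ).isHermitian i)))
    (ρ : UnitarilyInvariantNorm I) {f : ℝ → ℝ} (hf : IsContNonneg f) (hlog : LogConvexExp f) :
    ρ.normFun f hC ≤ expIntLog ν fun τ => ρ.normFun f (hD τ) := by
  have hpos := ((logMajorizedBy_iff hC hL).1 hmaj).1
  -- This disposes of f = 0 and r = 0, where the gauge vanishes and has no real logarithm.
  have hzero : (fun k => f (eigVec hC.isHermitian k)) = 0 →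
      ρ.normFun f hC ≤ expIntLog ν fun τ => ρ.normFun f (hD τ) := by
    intro h
    rw [ρ.normFun_of_pos hf.2 hC hpos, ρ.gauge_eq_zero_iff.2 h, ENNReal.ofReal_zero]
    exact zero_le
  rcases hlog.eq_zero_or_pos hf with h0 | hfpos
  · exact hzero (funext fun k => h0 _ (hpos k))
  rcases isEmpty_or_nonempty (Fin (tensorDim I)) with hemp | hne
  · exact hzero (Subsingleton.elim _ _)
  set F : (Fin (tensorDim I) → ℝ) → ℝ := fun x =>
    Real.log (ρ.gauge fun k => Real.exp (Real.log (f (Real.exp (x k))))) with hF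
  have hFlog : ∀ v : Fin (tensorDim I) → ℝ, (∀ i, 0 < v i) →
      ρ.gauge (fun i => f (v i)) = Real.exp (F fun i => Real.log (v i)) := by
    intro v hv
    simp only [hF, Real.exp_log (hv _), Real.exp_log (hfpos _ (hv _))]
    rw [Real.exp_log]
    exact ρ.gauge_pos fun h => (hfpos _ (hv _)).ne' (congrFun h (Classical.arbitrary _))
  rw [ρ.normFun_of_pos hf.2 hC hpos, hFlog _ hpos]
  refine le_of_tendsto (((ENNReal.continuous_ofReal.comp Real.continuous_exp).tendsto _).comp
    (tendsto_sub_nhdsGT_zero _)) ?_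
  filter_upwards [self_mem_nhdsWithin] with ε hε
  obtain ⟨h, hint, hle, hval⟩ := hL.exists_minorant hC hmaj (F := F)
    (ρ.convexOn_log_gauge_exp (hlog.convexOn_log hfpos))
    (fun σ v => congrArg Real.log (ρ.gauge_comp_perm σ
      fun k => Real.exp (Real.log (f (Real.exp (v k)))))) hε
  refine (ENNReal.ofReal_le_ofReal (Real.exp_le_exp.2 hval)).trans ?_
  rw [← expIntLog_ofReal_exp hint (ae_of_all _ fun _ => rfl)]
  refine expIntLog_mono_ae ?_
  filter_upwards [hL.pos] with τ hτ
  rw [ρ.normFun_of_pos hf.2 (hD τ) hτ, hFlog _ hτ]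
  exact ENNReal.ofReal_le_ofReal (Real.exp_le_exp.2 (hle τ))

lemma expIntLog_normFun_rpow_le [Nonempty (Fin (tensorDim I))] {hD : ∀ τ, (D τ).PosSemidef}
    (hL : LogIntegrable ν hD p) (ρ : UnitarilyInvariantNorm I) (q : ℝ) :
    expIntLog ν (fun τ => ρ.normFun (fun x => x ^ q) (hD τ)) ≤
      ∫⁻ τ, ρ.normFun (fun x => x ^ q) (hD τ) ∂ν := by
  have heq : ∀ᵐ τ ∂ν, ρ.normFun (fun x => x ^ q) (hD τ) =
      ENNReal.ofReal (ρ.gauge fun k => eigVec (hD τ).isHermitian k ^ q) := by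
    filter_upwards [hL.pos] with τ hτ
    exact ρ.normFun_of_pos (isContNonneg_rpow q).2 (hD τ) hτ
  rw [lintegral_congr_ae heq]
  refine (expIntLog_mono_ae (heq.mono fun _ h => h.le)).trans (expIntLog_le_lintegral ?_ ?_)
  · exact ρ.continuous_gauge.measurable.comp
      (measurable_pi_lambda _ fun k => (hL.measurable k).pow_const q)
  · filter_upwards [hL.pos] with τ hτ
    exact ρ.gauge_pos fun h =>
      (Real.rpow_pos_of_pos (hτ _) q).ne' (congrFun h (Classical.arbitrary _))

lemma logMajorizedBy_of_normFun_rpow_le [Nonempty (Fin (tensorDim I))] (hC : C.PosSemidef)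
    {hD : ∀ τ, (D τ).PosSemidef} (hL : LogIntegrable ν hD p) (hp : 0 < p)
    (h : ∀ (ρ : UnitarilyInvariantNorm I) (q : ℝ),
      ρ.normFun (fun x => x ^ q) hC ≤ ∫⁻ τ, ρ.normFun (fun x => x ^ q) (hD τ) ∂ν) :
    LogMajorizedBy (fun i => ENNReal.ofReal (eigVec hC.isHermitian i))
      (fun i => expIntLog ν fun τ => ENNReal.ofReal (eigVec (hD τ).isHermitian i)) := by
  have hr : 1 ≤ tensorDim I := Fin.pos_iff_nonempty.2 inferInstance
  have hneg : ∀ q : ℝ, 0 < q → ∀ v : Fin (tensorDim I) → ℝ, Antitone v → (∀ i, 0 < v i) →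
      (kyFan I (tensorDim I) hr).gauge (fun i => v i ^ (-q)) = ∑ i, v i ^ (-q) := by
    intro q hq v hv hv0
    exact gauge_kyFan_of_monotone hr
      (fun i j hij => Real.rpow_le_rpow_of_nonpos (hv0 j) (hv hij) (neg_nonpos.2 hq.le))
      fun i => Real.rpow_nonneg (hv0 i).le _
  -- A zero eigenvalue would make the left side infinite at q = -p, while the right side is a finite
  -- sum of integrable terms.
  have hpos : ∀ k, 0 < eigVec hC.isHermitian k := by
    intro k
    refine lt_of_le_of_ne (eigVec_nonneg hC k) fun hk => ?_
    have h1 := h (kyFan I (tensorDim I) hr) (-p)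
    rw [UnitarilyInvariantNorm.normFun_rpow_neg_eq_top _ hp hC hk.symm, top_le_iff] at h1
    refine ne_of_eq_of_ne (lintegral_congr_ae ?_)
      (integrable_finsetSum Finset.univ fun i _ => hL.exp_neg i).lintegral_lt_top.ne h1
    filter_upwards [hL.pos] with τ hτ
    rw [UnitarilyInvariantNorm.normFun_of_pos _ (isContNonneg_rpow _).2 (hD τ) hτ,
      hneg p hp _ (eigVec_antitone _) hτ]
    refine congrArg ENNReal.ofReal (Finset.sum_congr rfl fun i _ => ?_)
    rw [Real.rpow_def_of_pos (hτ i)]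
    congr 1
    ring
  have hle : ∀ k : ℕ, 1 ≤ k → k ≤ tensorDim I →
      ∑ i with (Fin.val i) < k, Real.log (eigVec hC.isHermitian i) ≤
        ∑ i with (Fin.val i) < k, ∫ τ, Real.log (eigVec (hD τ).isHermitian i) ∂ν := by
    intro k hk hkr
    refine sum_le_sum_integral_of_exp_le _ hL.log hp hL.exp fun q hq hqp => ?_
    refine sum_exp_le_of_normFun_le hC hL hpos (kyFan I k hk) (fun v hv hv0 => ?_)
      (fun i => integrable_exp_mul_of_le (hL.log i) (hL.exp i) hq hqp) (h _ q)
    exact gauge_kyFan hk hkr (fun i j hij => Real.rpow_le_rpow (hv0 j).le (hv hij) hq.le)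
      fun i => Real.rpow_nonneg (hv0 i).le _
  have hge : ∑ i, -Real.log (eigVec hC.isHermitian i) ≤
      ∑ i, ∫ τ, -Real.log (eigVec (hD τ).isHermitian i) ∂ν := by
    refine sum_le_sum_integral_of_exp_le _ (fun i => (hL.log i).neg) hp hL.exp_neg
      fun q hq hqp => ?_
    have h1 := sum_exp_le_of_normFun_le hC hL hpos (kyFan I (tensorDim I) hr) (q := -q)
      (S := Finset.univ) (hneg q hq) (fun i => by
        simpa using integrable_exp_mul_of_le (hL.log i).neg (hL.exp_neg i) hq hqp) (h _ _)
    simpa using h1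
  refine (logMajorizedBy_iff hC hL).2 ⟨hpos, hle, le_antisymm ?_ ?_⟩
  · simpa only [Fin.is_lt, Finset.filter_true] using hle (tensorDim I) hr le_rfl
  · simpa [integral_neg] using hge

end LogMajorization

theorem mainTheorem5 {Ω : Type*} [MetricSpace Ω] [SigmaCompactSpace Ω] [MeasurableSpace Ω]
    [BorelSpace Ω] (ν : Measure Ω) [IsProbabilityMeasure ν]
    {N : ℕ} (I : Fin N → ℕ)
    (C : SquareTensor I) (hC : C.PosSemidef)
    (D : Ω → SquareTensor I) (hD : ∀ τ, (D τ).PosSemidef)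
    (hDcont : Continuous D) (hDbdd : BddAbove (Set.range fun τ => frobNorm (D τ)))
    (ρ₀ : UnitarilyInvariantNorm I) (p : ℝ) (hp : 0 < p)
    (hDp : ∫⁻ τ, ρ₀.normFun (fun x => x ^ (-p)) (hD τ) ∂ν < ∞) :
    List.TFAE [
      LogMajorizedBy (fun i => ENNReal.ofReal (eigVec hC.isHermitian i))
        (fun i => expIntLog ν fun τ => ENNReal.ofReal (eigVec (hD τ).isHermitian i)),
      ∀ (ρ : UnitarilyInvariantNorm I) (f : ℝ → ℝ), IsContNonneg f → LogConvexExp f →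
        ρ.normFun f hC ≤ expIntLog ν fun τ => ρ.normFun f (hD τ),
      ∀ (ρ : UnitarilyInvariantNorm I) (g : ℝ → ℝ), IsContNonneg g →
        ConvexOn ℝ Set.univ (fun x : ℝ => g (Real.exp x)) →
        ρ.normFun g hC ≤ ∫⁻ τ, ρ.normFun g (hD τ) ∂ν] := by

  have hL : LogIntegrable ν hD p := logIntegrable hD hDcont hDbdd ρ₀ hp hDp
  tfae_have 1 → 2 := fun h ρ f hf hlog => normFun_le_expIntLog hC hL h ρ hf hlog
  tfae_have 1 → 3 := fun h ρ g hg hconv => normFun_le_lintegral hC hL h ρ hg hconv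
  -- When r = 0 there is no Ky Fan norm with 1 ≤ k ≤ r to test on, but condition 1 compares empty
  -- products.
  rcases isEmpty_or_nonempty (Fin (tensorDim I)) with hemp | hne
  · have h1 : LogMajorizedBy (fun i => ENNReal.ofReal (eigVec hC.isHermitian i))
        (fun i => expIntLog ν fun τ => ENNReal.ofReal (eigVec (hD τ).isHermitian i)) :=
      (logMajorizedBy_iff hC hL).2 ⟨fun k => isEmptyElim k, by simp, by simp⟩
    tfae_have 2 → 1 := fun _ => h1
    tfae_have 3 → 1 := fun _ => h1
    tfae_finish
  · tfae_have 2 → 1 := fun h => logMajorizedBy_of_normFun_rpow_le hC hL hp fun ρ q =>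
      (h ρ _ (isContNonneg_rpow q) (logConvexExp_rpow q)).trans (expIntLog_normFun_rpow_le hL ρ q)
    tfae_have 3 → 1 := fun h => logMajorizedBy_of_normFun_rpow_le hC hL hp fun ρ q =>
      h ρ _ (isContNonneg_rpow q) (convexOn_rpow_exp q)
    tfae_finish
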